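/- A hypergraph $H=(V,E)$ consists of a finite set $V$ of vertices and a family $E$ of subsets of $V$, called edges; it is $n$-uniform if every edge has exactly $n$ vertices. A coloring of $V$ is proper if every edge contains two vertices of different colors, and the chromatic number of $H$ is the smallest number of colors in a proper coloring of $H$. Let $m(n,r)$ be the minimal number of edges in an $n$-uniform hypergraph with chromatic number more than $r$. Then there are a real constant $c=0.324\dots$ (that is, $0.324<c<0.325$) and a number $r_0$ such that for all integers $r>r_0$ $$m(3,r)\ \ge\ c\,r^3 .$$ -/

import Mathlib

namespace HypergraphColoring

/-- Every edge of `H` has exactly `n` vertices. -/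
def IsUniform {α : Type*} (H : Hypergraph α) (n : ℕ) : Prop :=
  ∀ e ∈ H.edgeSet, e.encard = n

/-- A coloring of the vertices of `H` is proper if every edge contains two vertices of different
colors. -/
def IsProper {α : Type*} (H : Hypergraph α) {r : ℕ} (col : H.vertexSet → Fin r) : Prop :=
  ∀ e ∈ H.edgeSet, ∃ u v : H.vertexSet, (u : α) ∈ e ∧ (v : α) ∈ e ∧ col u ≠ col v

/-- `H` has a proper coloring with `r` colors. -/
def Colorable {α : Type*} (H : Hypergraph α) (r : ℕ) : Prop :=
  ∃ col : H.vertexSet → Fin r, IsProper H col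

/-- The smallest `r` such that `H` has a proper coloring with `r` colors (`⊤` if there is none,
which for a finite vertex set happens only when some edge has at most one vertex). -/
noncomputable def chromaticNumber {α : Type*} (H : Hypergraph α) : ℕ∞ :=
  ⨅ r : {r : ℕ // Colorable H r}, ((r : ℕ) : ℕ∞)

/-- `m n r` is the minimal number of edges in an `n`-uniform hypergraph (with finitely many
vertices) whose chromatic number is more than `r`. -/
noncomputable def m (n r : ℕ) : ℕ :=
  sInf {N : ℕ | ∃ (α : Type) (H : Hypergraph α), H.vertexSet.Finite ∧
    IsUniform H n ∧ (r : ℕ∞) < chromaticNumber H ∧ H.edgeSet.ncard = N}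

end HypergraphColoring

namespace HypergraphColoring

/-! Color in two rounds. Some coloring with `a` colors leaves at most `N / a ^ 2` of the `N` edges
monochromatic. Inside a class with `x` such edges, use `k` fresh colors and discard `d` vertices,
where `k + d / 2 ≤ 1.68 + 0.16 x` (`exists_coloring_deletion`). The discarded vertices of all
classes are then colored in pairs, which no triple survives, at half a color each. About `1.68 a +
0.16 N / a ^ 2` colors suffice, so non-`r`-colorability forces `N > (50 r a ^ 2 - 84 a ^ 3) / 8`; `a
≈ 0.4 r` gives about `0.328 r ^ 3`. -/

/-- The edges of `E` on which `col` is constant with value `i`. -/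
def monoEdges {V C : Type*} [DecidableEq C] (E : Finset (Finset V)) (col : V → C) (i : C) :
    Finset (Finset V) :=
  {e ∈ E | ∀ v ∈ e, col v = i}

lemma mem_monoEdges {V C : Type*} [DecidableEq C] {E : Finset (Finset V)} {col : V → C} {i : C}
    {e : Finset V} : e ∈ monoEdges E col i ↔ e ∈ E ∧ ∀ v ∈ e, col v = i := by
  simp [monoEdges]

/-! ### Averaging over colorings -/

lemma card_filter_mono_mul_sq_le {V C : Type*} [Fintype V] [DecidableEq V] [Fintype C]
    [DecidableEq C] {e : Finset V} (he : e.card = 3) :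
    (Finset.univ.filter fun col : V → C => ∃ i, ∀ v ∈ e, col v = i).card * Fintype.card C ^ 2 ≤
      Fintype.card (V → C) := by
  obtain ⟨x, y, z, hxy, hxz, hyz, rfl⟩ := Finset.card_eq_three.1 he
  have h := Finset.card_le_card_of_injOn
    (s := (Finset.univ.filter fun col : V → C => ∃ i, ∀ v ∈ ({x, y, z} : Finset V), col v = i) ×ˢ
      (Finset.univ : Finset (C × C))) (t := (Finset.univ : Finset (V → C)))
    -- Overwriting the colors at `y` and `z` loses nothing: both equal the color kept at `x`.
    (fun p => Function.update (Function.update p.1 y p.2.1) z p.2.2) (by simp) ?_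
  · simpa [Finset.card_product, sq] using h
  · rintro ⟨f, s, t⟩ hf ⟨g, s', t'⟩ hg hfg
    simp only [Finset.coe_product, Set.mem_prod, Finset.mem_coe, Finset.mem_filter,
      Finset.mem_univ, true_and, and_true, Finset.mem_insert, Finset.mem_singleton,
      forall_eq_or_imp, forall_eq] at hf hg
    obtain ⟨i, hfx, hfy, hfz⟩ := hf
    obtain ⟨j, hgx, hgy, hgz⟩ := hg
    have key (v : V) := congrFun hfg v
    have ht : t = t' := by simpa using key z
    have hs : s = s' := by simpa [hyz] using key y
    have hij : i = j := by simpa [hxy, hxz, hfx, hgx] using key x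
    have : f = g := by
      funext v
      by_cases hvz : v = z
      · rw [hvz, hfz, hgz, hij]
      by_cases hvy : v = y
      · rw [hvy, hfy, hgy, hij]
      simpa [hvz, hvy] using key v
    simp [this, hs, ht]

lemma sum_card_monoEdges {V C : Type*} [DecidableEq V] [Fintype C]
    [DecidableEq C] {E : Finset (Finset V)} (hE : ∀ e ∈ E, e.card = 3) (col : V → C) :
    ∑ i, (monoEdges E col i).card = (E.filter fun e => ∃ i, ∀ v ∈ e, col v = i).card := by
  rw [← Finset.card_biUnion]
  · congr 1
    ext e
    simp [mem_monoEdges]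
  · intro i _ j _ hij
    rw [Function.onFun, Finset.disjoint_left]
    intro e hi hj
    rw [mem_monoEdges] at hi hj
    obtain ⟨v, hv⟩ := Finset.card_pos.1 (by rw [hE e hi.1]; norm_num)
    exact hij ((hi.2 v hv).symm.trans (hj.2 v hv))

lemma sum_sum_card_monoEdges_mul_le {V C : Type*} [Fintype V] [DecidableEq V] [Fintype C]
    [DecidableEq C] {E : Finset (Finset V)} (hE : ∀ e ∈ E, e.card = 3) :
    ∑ col : V → C, (∑ i, (monoEdges E col i).card) * Fintype.card C ^ 2 ≤
      ∑ _col : V → C, E.card := by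
  simp_rw [sum_card_monoEdges hE, Finset.card_filter]
  rw [← Finset.sum_mul, Finset.sum_comm, Finset.sum_mul]
  calc _ ≤ ∑ e ∈ E, Fintype.card (V → C) := by
        refine Finset.sum_le_sum fun e he => ?_
        have := card_filter_mono_mul_sq_le (C := C) (hE e he)
        rw [Finset.card_filter] at this
        refine le_trans (le_of_eq ?_) this
        congr!
    _ = _ := by simp [mul_comm]

lemma exists_sum_card_monoEdges_mul_le {V C : Type*} [Fintype V] [DecidableEq V] [Fintype C]
    [DecidableEq C] [Nonempty C] {E : Finset (Finset V)} (hE : ∀ e ∈ E, e.card = 3) :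
    ∃ col : V → C, (∑ i, (monoEdges E col i).card) * Fintype.card C ^ 2 ≤ E.card := by
  obtain ⟨col, -, h⟩ := Finset.exists_le_of_sum_le Finset.univ_nonempty
    (sum_sum_card_monoEdges_mul_le (C := C) hE)
  exact ⟨col, h⟩

/-- Constant colorings are strictly worse than average, so some coloring is strictly better. -/
lemma exists_sum_card_monoEdges_mul_lt {V C : Type*} [Fintype V] [DecidableEq V] [Fintype C]
    [DecidableEq C] [Nontrivial C] {E : Finset (Finset V)} (hE : ∀ e ∈ E, e.card = 3)
    (hne : E.Nonempty) :
    ∃ col : V → C, (∑ i, (monoEdges E col i).card) * Fintype.card C ^ 2 < E.card := by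
  by_contra! h
  refine (sum_sum_card_monoEdges_mul_le (C := C) hE).not_gt
    (Finset.sum_lt_sum (fun col _ => h col) ?_)
  obtain ⟨i⟩ : Nonempty C := inferInstance
  refine ⟨fun _ => i, Finset.mem_univ _, ?_⟩
  have h1 : E.card ≤ ∑ j, (monoEdges E (fun _ => i) j).card := by
    calc E.card = (monoEdges E (fun _ => i) i).card := by simp [monoEdges]
      _ ≤ _ := Finset.single_le_sum (f := fun j => (monoEdges E (fun _ => i) j).card)
        (fun _ _ => Nat.zero_le _) (Finset.mem_univ i)
  have h2 : 2 ≤ Fintype.card C := Fintype.one_lt_card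
  calc E.card < E.card * 2 ^ 2 := by have := hne.card_pos; omega
    _ ≤ _ := Nat.mul_le_mul h1 (Nat.pow_le_pow_left h2 2)

/-! ### Two-coloring five triples -/

/-- Five triples on at most six points admit a proper two-coloring by a balanced split. -/
lemma exists_bool_coloring_of_card_le_six {V : Type*} [Fintype V] [DecidableEq V]
    (hV : Fintype.card V ≤ 6) {E : Finset (Finset V)} (hE : ∀ e ∈ E, e.card = 3)
    (hcard : E.card ≤ 5) : ∃ col : V → Bool, ∀ e ∈ E, ∀ b, ∃ v ∈ e, col v ≠ b := by
  obtain ⟨φ⟩ : Nonempty (V ↪ Fin 6) :=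
    Function.Embedding.nonempty_of_card_le (by simpa using hV)
  set F : Finset (Finset (Fin 6)) := E.image (fun e => e.map φ) with hF
  have hFc : F.card ≤ 5 := Finset.card_image_le.trans hcard
  -- At most 10 of the 20 triples are an edge or the complement of one.
  have hlt : (F ∪ F.image compl).card < (Finset.powersetCard 3 (Finset.univ : Finset (Fin 6))).card := by
    have h1 := Finset.card_union_le F (F.image compl)
    have h2 : (F.image compl).card ≤ F.card := Finset.card_image_le
    rw [Finset.card_powersetCard, Finset.card_univ, Fintype.card_fin]
    have : Nat.choose 6 3 = 20 := rfl
    omega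
  obtain ⟨A, hA, hAF⟩ := Finset.exists_mem_notMem_of_card_lt_card hlt
  have hA3 : A.card = 3 := (Finset.mem_powersetCard.1 hA).2
  refine ⟨fun v => decide (φ v ∈ A), fun e he b => ?_⟩
  by_contra! h
  have heF : e.map φ ∈ F := Finset.mem_image_of_mem _ he
  cases b with
  | true =>
    have : e.map φ = A := Finset.eq_of_subset_of_card_le
      (fun x hx => by
        obtain ⟨v, hv, rfl⟩ := Finset.mem_map.1 hx
        simpa using h v hv) (by rw [Finset.card_map, hE e he, hA3])
    exact hAF (Finset.mem_union_left _ (this ▸ heF))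
  | false =>
    have : e.map φ = Aᶜ := Finset.eq_of_subset_of_card_le
      (fun x hx => by
        obtain ⟨v, hv, rfl⟩ := Finset.mem_map.1 hx
        simpa using h v hv) (by rw [Finset.card_map, hE e he, Finset.card_compl, hA3]; simp)
    exact hAF (Finset.mem_union_right _ (Finset.mem_image.2 ⟨_, heF, by rw [this, compl_compl]⟩))

/-- Every 3-uniform hypergraph with at most five edges has a proper two-coloring. -/
lemma exists_bool_coloring_of_card_le_five (n : ℕ) :
    ∀ {V : Type*} [Fintype V] [DecidableEq V], Fintype.card V ≤ n → ∀ {E : Finset (Finset V)},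
      (∀ e ∈ E, e.card = 3) → E.card ≤ 5 →
      ∃ col : V → Bool, ∀ e ∈ E, ∀ b, ∃ v ∈ e, col v ≠ b := by
  induction n with
  | zero => exact fun hV _ hE hc => exists_bool_coloring_of_card_le_six (by omega) hE hc
  | succ n ih =>
    intro V _ _ hV E hE hc
    by_cases h6 : Fintype.card V ≤ 6
    · exact exists_bool_coloring_of_card_le_six h6 hE hc
    -- Five triples cover at most 30 ordered pairs, fewer than the 42 on seven points. Identifying
    -- an uncovered pair keeps all edges of size 3.
    have hlt : (E.biUnion fun e => e.offDiag).card < (Finset.univ : Finset V).offDiag.card := by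
      have h1 : (E.biUnion fun e => e.offDiag).card ≤ E.card * 6 :=
        Finset.card_biUnion_le_card_mul _ _ _ fun e he => by simp [Finset.offDiag_card, hE e he]
      rw [Finset.offDiag_card, Finset.card_univ, ← Nat.mul_sub_one]
      have h2 : 7 * 6 ≤ Fintype.card V * (Fintype.card V - 1) :=
        Nat.mul_le_mul (by omega) (by omega)
      omega
    obtain ⟨⟨i, j⟩, hij, hijE⟩ := Finset.exists_mem_notMem_of_card_lt_card hlt
    have hne : i ≠ j := (Finset.mem_offDiag.1 hij).2.2
    have hsep : ∀ e ∈ E, i ∈ e → j ∉ e := fun e he hi hj =>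
      hijE (Finset.mem_biUnion.2 ⟨e, he, Finset.mem_offDiag.2 ⟨hi, hj, hne⟩⟩)
    let ψ : V → {x : V // x ≠ i} := fun x => if h : x = i then ⟨j, hne.symm⟩ else ⟨x, h⟩
    have hinj : ∀ e ∈ E, Set.InjOn ψ e := by
      intro e he x hx y hy hxy
      have hs := hsep e he
      simp only [ψ] at hxy
      split_ifs at hxy with h1 h2 h2
      · rw [h1, h2]
      · have h3 : j = y := by simpa using hxy
        subst h1; subst h3
        exact absurd hy (hs hx)
      · have h3 : x = j := by simpa using hxy
        subst h2; subst h3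
        exact absurd hx (hs hy)
      · simpa using hxy
    obtain ⟨col, hcol⟩ := ih (V := {x : V // x ≠ i})
      (by
        have := Fintype.card_subtype_lt (p := fun x => x ≠ i) (x := i) (by simp)
        omega)
      (E := E.image fun e => e.image ψ)
      (by
        intro _ he'
        obtain ⟨e, he, rfl⟩ := Finset.mem_image.1 he'
        rw [Finset.card_image_of_injOn (hinj e he), hE e he])
      (Finset.card_image_le.trans hc)
    refine ⟨col ∘ ψ, fun e he b => ?_⟩
    obtain ⟨v, hv, hvb⟩ := hcol _ (Finset.mem_image_of_mem _ he) b
    obtain ⟨w, hw, rfl⟩ := Finset.mem_image.1 hv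
    exact ⟨w, hw, hvb⟩

/-! ### Repairing classes and combining them -/

lemma exists_transversal {V : Type*} [DecidableEq V] {E : Finset (Finset V)}
    (hE : ∀ e ∈ E, e.Nonempty) : ∃ D : Finset V, D.card ≤ E.card ∧ ∀ e ∈ E, ∃ v ∈ e, v ∈ D := by
  choose f hf using hE
  refine ⟨E.attach.image fun e => f e.1 e.2, ?_, fun e he => ⟨f e he, hf e he, ?_⟩⟩
  · simpa using Finset.card_image_le (s := E.attach) (f := fun e => f e.1 e.2)
  · exact Finset.mem_image.2 ⟨⟨e, he⟩, Finset.mem_attach _ _, rfl⟩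

/-- A 3-uniform hypergraph with `x` edges becomes properly `k`-colorable after deleting `d`
vertices, where `k + d / 2 ≤ 1.68 + 0.16 x`. -/
lemma exists_coloring_deletion {V : Type*} [Fintype V] [DecidableEq V] {E : Finset (Finset V)}
    (hE : ∀ e ∈ E, e.card = 3) :
    ∃ (k : ℕ) (D : Finset V) (col : V → Fin k), 50 * k + 25 * D.card ≤ 84 + 8 * E.card ∧
      ∀ e ∈ E, ∀ i, ∃ v ∈ e, v ∈ D ∨ col v ≠ i := by
  have hpos : ∀ e ∈ E, e.Nonempty := fun e he => Finset.card_pos.1 (by rw [hE e he]; norm_num)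
  by_cases h1 : E.card ≤ 1
  · obtain ⟨D, hD, hDE⟩ := exists_transversal hpos
    refine ⟨1, D, fun _ => 0, by omega, fun e he i => ?_⟩
    obtain ⟨v, hv, hvD⟩ := hDE e he
    exact ⟨v, hv, Or.inl hvD⟩
  -- Averaging alone allows one bad edge here, costing 125 against a bound of 124.
  by_cases h5 : E.card = 5
  · obtain ⟨col, hcol⟩ := exists_bool_coloring_of_card_le_five _ le_rfl hE h5.le
    refine ⟨2, ∅, fun v => finTwoEquiv.symm (col v), by simp [h5], fun e he i => ?_⟩
    obtain ⟨v, hv, hvi⟩ := hcol e he (finTwoEquiv i)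
    exact ⟨v, hv, Or.inr fun h => hvi (by rw [← h, Equiv.apply_symm_apply])⟩
  obtain ⟨col, hcol⟩ := exists_sum_card_monoEdges_mul_lt (C := Fin 2) hE
    (Finset.card_pos.1 (by omega))
  obtain ⟨D, hD, hDE⟩ := exists_transversal
    (E := Finset.univ.biUnion fun i => monoEdges E col i) (by
      intro e he
      obtain ⟨i, -, hi⟩ := Finset.mem_biUnion.1 he
      exact hpos e (mem_monoEdges.1 hi).1)
  have hD' := hD.trans Finset.card_biUnion_le
  rw [Fintype.card_fin] at hcol
  refine ⟨2, D, col, by omega, fun e he i => ?_⟩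
  by_cases hi : ∀ v ∈ e, col v = i
  · obtain ⟨v, hv, hvD⟩ := hDE e
      (Finset.mem_biUnion.2 ⟨i, Finset.mem_univ _, mem_monoEdges.2 ⟨he, hi⟩⟩)
    exact ⟨v, hv, Or.inl hvD⟩
  · push Not at hi
    obtain ⟨v, hv, hvi⟩ := hi
    exact ⟨v, hv, Or.inr hvi⟩

/-- A finite set can be colored with every color used at most twice, using half as many colors as
there are elements (rounded up). -/
lemma exists_pairing {V : Type*} [DecidableEq V] (D : Finset V) :
    ∃ f : D → Fin ((D.card + 1) / 2), ∀ i, (Finset.univ.filter fun v => f v = i).card ≤ 2 := by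
  refine ⟨fun v => ⟨D.equivFin v / 2, by have := (D.equivFin v).2; omega⟩, fun i => ?_⟩
  calc _ ≤ ({2 * i.1, 2 * i.1 + 1} : Finset ℕ).card := by
        refine Finset.card_le_card_of_injOn (fun v => (D.equivFin v : ℕ)) ?_ ?_
        · intro v hv
          have hv' : (D.equivFin v : ℕ) / 2 = i := by simpa [Fin.ext_iff] using hv
          simp only [Finset.coe_insert, Finset.coe_singleton, Set.mem_insert_iff,
            Set.mem_singleton_iff]
          omega
        · intro v _ w _ h
          exact D.equivFin.injective (Fin.ext h)
    _ ≤ 2 := Finset.card_le_two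

/-- A 3-uniform hypergraph with `N` edges, where `84 a ^ 3 + 8 N ≤ 50 r a ^ 2`, is
`r`-colorable. -/
lemma exists_coloring_of_le {V : Type*} [Fintype V] [DecidableEq V] {E : Finset (Finset V)}
    (hE : ∀ e ∈ E, e.card = 3) {a r : ℕ} (ha : 0 < a)
    (h : 84 * a ^ 3 + 8 * E.card ≤ 50 * r * a ^ 2) :
    ∃ col : V → Fin r, ∀ e ∈ E, ∀ i, ∃ v ∈ e, col v ≠ i := by
  have : NeZero a := ⟨ha.ne'⟩
  obtain ⟨c, hc⟩ := exists_sum_card_monoEdges_mul_le (C := Fin a) hE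
  rw [Fintype.card_fin] at hc
  have hloc (i : Fin a) := exists_coloring_deletion (E := monoEdges E c i)
    fun e he => hE e (mem_monoEdges.1 he).1
  choose k D g hk hg using hloc
  set U : Finset V := Finset.univ.biUnion D with hU
  obtain ⟨f, hf⟩ := exists_pairing U
  have hUc : U.card ≤ ∑ i, (D i).card := Finset.card_biUnion_le
  have hsum : 50 * ∑ i, k i + 25 * ∑ i, (D i).card ≤
      84 * a + 8 * ∑ i, (monoEdges E c i).card := by
    have := Finset.sum_le_sum fun i (_ : i ∈ Finset.univ) => hk i
    simpa [Finset.sum_add_distrib, ← Finset.mul_sum, mul_comm a] using this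
  have htot : 84 * a + 8 * ∑ i, (monoEdges E c i).card ≤ 50 * r := by
    refine Nat.le_of_mul_le_mul_right ?_ (pow_pos ha 2)
    nlinarith
  let col : V → (Σ i, Fin (k i)) ⊕ Fin ((U.card + 1) / 2) := fun v =>
    if hv : v ∈ U then Sum.inr (f ⟨v, hv⟩) else Sum.inl ⟨c v, g (c v) v⟩
  obtain ⟨ι⟩ : Nonempty ((Σ i, Fin (k i)) ⊕ Fin ((U.card + 1) / 2) ↪ Fin r) := by
    refine Function.Embedding.nonempty_of_card_le ?_
    simp only [Fintype.card_sum, Fintype.card_sigma, Fintype.card_fin]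
    -- Rounding up the pairing is free: `2 * ∑ k + ∑ d ≤ 2 * r` has an even right side.
    omega
  have hcol : ∀ e ∈ E, ∀ i, ∃ v ∈ e, col v ≠ i := by
    intro e he i
    by_contra! hmono
    have h3 := hE e he
    rcases i with ⟨i, j⟩ | i
    · have hv : ∀ v ∈ e, v ∉ U ∧ c v = i ∧ g i v = j := by
        intro v hv
        have hvm := hmono v hv
        simp only [col] at hvm
        split_ifs at hvm with hvU
        simp only [Sum.inl.injEq, Sigma.mk.injEq] at hvm
        obtain ⟨rfl, hvj⟩ := hvm
        exact ⟨hvU, rfl, eq_of_heq hvj⟩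
      obtain ⟨v, hve, hvD⟩ := hg i e (mem_monoEdges.2 ⟨he, fun v hve => (hv v hve).2.1⟩) j
      rcases hvD with hvD | hvD
      · exact (hv v hve).1 (Finset.mem_biUnion.2 ⟨i, Finset.mem_univ _, hvD⟩)
      · exact hvD (hv v hve).2.2
    · have hv : ∀ v ∈ e, ∃ hvU : v ∈ U, f ⟨v, hvU⟩ = i := by
        intro v hv
        have hvm := hmono v hv
        simp only [col] at hvm
        split_ifs at hvm with hvU
        exact ⟨hvU, by simpa using hvm⟩
      have hsub : e ⊆ (Finset.univ.filter fun v => f v = i).map (Function.Embedding.subtype _) := by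
        intro v hve
        obtain ⟨hvU, hvi⟩ := hv v hve
        exact Finset.mem_map.2 ⟨⟨v, hvU⟩, by simpa using hvi, rfl⟩
      have := (Finset.card_le_card hsub).trans ((Finset.card_map _).trans_le (hf i))
      omega
  refine ⟨ι ∘ col, fun e he i => ?_⟩
  obtain ⟨v₀, hv₀⟩ := Finset.card_pos.1 (by rw [hE e he]; norm_num : 0 < e.card)
  by_cases hi : ι (col v₀) = i
  · obtain ⟨v, hv, hvi⟩ := hcol e he (col v₀)
    exact ⟨v, hv, fun h => hvi (ι.injective (h.trans hi.symm))⟩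
  · exact ⟨v₀, hv₀, hi⟩

/-! ### Transfer to `Hypergraph` and `m` -/

lemma colorable_of_le {α : Type*} {H : Hypergraph α} (hfin : H.vertexSet.Finite)
    (hH : IsUniform H 3) {a r : ℕ} (ha : 0 < a)
    (h : 84 * a ^ 3 + 8 * H.edgeSet.ncard ≤ 50 * r * a ^ 2) : Colorable H r := by
  classical
  have : Fintype H.vertexSet := hfin.fintype
  let im : Finset H.vertexSet → Set α := fun s => (↑) '' (s : Set H.vertexSet)
  have him : Function.Injective im := fun s t hst =>
    Finset.coe_injective (Subtype.val_injective.image_injective hst)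
  have hedge : H.edgeSet.Finite :=
    hfin.finite_subsets.subset fun e he => H.subset_vertexSet_of_mem_edgeSet he
  let E : Finset (Finset H.vertexSet) := Finset.univ.filter fun s => im s ∈ H.edgeSet
  have hmem : ∀ s, s ∈ E ↔ im s ∈ H.edgeSet := by simp [E]
  have hcard : E.card ≤ H.edgeSet.ncard := by
    rw [← Set.ncard_coe_finset]
    exact Set.ncard_le_ncard_of_injOn im (fun s hs => (hmem s).1 hs) him.injOn hedge
  obtain ⟨col, hcol⟩ := exists_coloring_of_le (E := E) (a := a) (r := r) (by
    intro s hs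
    have := hH _ ((hmem s).1 hs)
    rw [Subtype.val_injective.encard_image, Set.encard_coe_eq_coe_finsetCard] at this
    exact_mod_cast this) ha (by omega)
  refine ⟨col, fun e he => ?_⟩
  have hsub := H.subset_vertexSet_of_mem_edgeSet he
  let s : Finset H.vertexSet := Finset.univ.filter fun v => (v : α) ∈ e
  have hs : im s = e := by
    ext x
    simp only [im, s, Finset.coe_filter, Finset.mem_univ, true_and, Set.mem_image,
      Set.mem_ofPred_eq]
    exact ⟨fun ⟨v, hv, hvx⟩ => hvx ▸ hv, fun hx => ⟨⟨x, hsub hx⟩, hx, rfl⟩⟩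
  have hsE : s ∈ E := (hmem s).2 (hs ▸ he)
  obtain ⟨x, hx⟩ : e.Nonempty := by
    rw [← Set.encard_ne_zero, hH e he]
    norm_num
  obtain ⟨v, hv, hne⟩ := hcol s hsE (col ⟨x, hsub hx⟩)
  exact ⟨v, ⟨x, hsub hx⟩, (Finset.mem_filter.1 hv).2, hx, hne⟩

lemma Colorable.chromaticNumber_le {α : Type*} {H : Hypergraph α} {r : ℕ} (h : Colorable H r) :
    chromaticNumber H ≤ r :=
  iInf_le (fun r : {r : ℕ // Colorable H r} => ((r : ℕ) : ℕ∞)) ⟨r, h⟩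

/-- The complete `n`-uniform hypergraph on `Fin k`. -/
def complete (n k : ℕ) : Hypergraph (Fin k) where
  vertexSet := Set.univ
  edgeSet := {e | e.encard = n}
  subset_vertexSet_of_mem_edgeSet' := fun _ _ => Set.subset_univ _

lemma lt_chromaticNumber_complete (r : ℕ) : (r : ℕ∞) < chromaticNumber (complete 3 (2 * r + 1)) := by
  suffices h : ((r + 1 : ℕ) : ℕ∞) ≤ chromaticNumber (complete 3 (2 * r + 1)) from
    lt_of_lt_of_le (by exact_mod_cast r.lt_succ_self) h
  refine le_iInf fun ⟨s, col, hcol⟩ => ?_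
  by_contra! hlt
  have hs : s ≤ r := by
    have : s < r + 1 := by exact_mod_cast hlt
    omega
  let c : Fin (2 * r + 1) → Fin s := fun v => col ⟨v, Set.mem_univ v⟩
  obtain ⟨i, -, hi⟩ := Finset.exists_lt_card_fiber_of_mul_lt_card_of_maps_to
    (s := Finset.univ) (t := Finset.univ) (f := c) (n := 2) (fun _ _ => Finset.mem_univ _)
    (by simp only [Finset.card_univ, Fintype.card_fin]; omega)
  obtain ⟨e, he, he3⟩ := Finset.exists_subset_card_eq (Nat.succ_le_of_lt hi)
  obtain ⟨u, v, hu, hv, huv⟩ := hcol (e : Set (Fin (2 * r + 1)))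
    (by simp [complete, Set.encard_coe_eq_coe_finsetCard, he3])
  have hu' : c u = i := (Finset.mem_filter.1 (he hu)).2
  have hv' : c v = i := (Finset.mem_filter.1 (he hv)).2
  exact huv (hu'.trans hv'.symm)

/-- `m 3 r` is attained. -/
lemma exists_ncard_eq_m (r : ℕ) : ∃ (α : Type) (H : Hypergraph α), H.vertexSet.Finite ∧
    IsUniform H 3 ∧ (r : ℕ∞) < chromaticNumber H ∧ H.edgeSet.ncard = m 3 r :=
  Nat.sInf_mem (s := {N : ℕ | ∃ (α : Type) (H : Hypergraph α), H.vertexSet.Finite ∧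
    IsUniform H 3 ∧ (r : ℕ∞) < chromaticNumber H ∧ H.edgeSet.ncard = N})
    ⟨_, Fin (2 * r + 1), complete 3 (2 * r + 1), Set.toFinite _, fun _ he => he,
      lt_chromaticNumber_complete r, rfl⟩

lemma lt_m_three {a r : ℕ} (ha : 0 < a) : 50 * r * a ^ 2 < 84 * a ^ 3 + 8 * m 3 r := by
  obtain ⟨α, H, hfin, hH, hr, hN⟩ := exists_ncard_eq_m r
  by_contra! h
  exact hr.not_ge (colorable_of_le hfin hH ha (by rwa [hN])).chromaticNumber_le

end HypergraphColoring

theorem mainTheorem4 :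
    ∃ c : ℝ, 0.324 < c ∧ c < 0.325 ∧
      ∃ r₀ : ℕ, ∀ r : ℕ, r₀ < r → c * (r : ℝ) ^ 3 ≤ (HypergraphColoring.m 3 r : ℝ) := by
  refine ⟨0.3245, by norm_num, by norm_num, 1000, fun r hr => ?_⟩
  -- The ratio `2 / 5` is close to the optimum `25 / 63`; the slack `0.328 - 0.3245` absorbs the
  -- floor once `r > 1000`.
  set a := 2 * r / 5 with ha
  have h1 : 5 * a ≤ 2 * r := by omega
  have h2 : 2 * r ≤ 5 * a + 5 := by omega
  have h := HypergraphColoring.lt_m_three (a := a) (r := r) (by omega)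
  generalize a = b at *
  have h' : (50 * r * b ^ 2 : ℝ) ≤ 84 * b ^ 3 + 8 * HypergraphColoring.m 3 r := by
    exact_mod_cast h.le
  have h1' : (5 * b : ℝ) ≤ 2 * r := by exact_mod_cast h1
  have h2' : (2 * r : ℝ) ≤ 5 * b + 5 := by exact_mod_cast h2
  have hr' : (1000 : ℝ) ≤ r := by exact_mod_cast hr.le
  have hb : (0.4 * r - 1 : ℝ) ^ 2 ≤ (b : ℝ) ^ 2 := by
    apply pow_le_pow_left₀ <;> linarith
  -- Here `16.4 = 50 - 84 * 0.4`.
  have h3 : (b : ℝ) ^ 2 * (16.4 * r) ≤ b ^ 2 * (50 * r - 84 * b) :=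
    mul_le_mul_of_nonneg_left (by linarith) (sq_nonneg _)
  have h4 : (0.4 * r - 1 : ℝ) ^ 2 * (16.4 * r) ≤ b ^ 2 * (16.4 * r) :=
    mul_le_mul_of_nonneg_right hb (by linarith)
  have h5 : (1000 : ℝ) * r ^ 2 ≤ r * r ^ 2 := mul_le_mul_of_nonneg_right hr' (sq_nonneg _)
  nlinarith
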